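/- Let $k$ be a field and $P=k[x_1,\dots,x_n]$ with its standard grading. Let $J\subset P$ be a homogeneous ideal of height two which is perfect, i.e. the projective dimension of $P/J$ over $P$ equals the grade of $J$. Let $h=(h(j))_{j\ge 0}$ be the $h$-vector of $P/J$, i.e. $$\sum_{j\ge 0}h(j)t^j=(1-t)^{n-2}\sum_{i\ge 0}\dim_k (P/J)_i\,t^i,$$ and put $\Delta^2h(j)=h(j)-2h(j-1)+h(j-2)$ for $j\ge 0$, where $h(-1)=h(-2)=0$. Let $\mathcal I=\{j\ge 0: \Delta^2h(j)\le -1\}$ and $\mathcal J=\{j\ge 1:\Delta^2h(j)\ge 1\}$. Let $\nu(J)$ be the minimal number of generators of $J$. The ideal $J$ has a minimal graded free resolution $\cdots\to F_1\to F_0\to J\to 0$ over $P$ with $F_i$ of finite rank; write $F_i=\bigoplus_j P(-j)^{\beta_{ij}(J)}$. Then $\mathcal I$ is finite and the following hold. 1. $\displaystyle \nu(J)\ge\sum_{i\in\mathcal I}|\Delta^2h(i)|.$ 2. If equality holds in (1), then the graded Betti numbers of $J$ are uniquely determined by $h$: in every minimal graded free resolution of $J$ and for all $j\ge 0$, $$\beta_{0j}(J)=\begin{cases}|\Delta^2h(j)|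 & j\in\mathcal I,\\ 0&\text{otherwise,}\end{cases}\qquad \beta_{1j}(J)=\begin{cases}|\Delta^2h(j)| & j\in\mathcal J,\\ 0&\text{otherwise,}\end{cases}$$ and $\beta_{ij}(J)=0$ for all $i\ge 2$. -/

import Mathlib

open MvPolynomial

attribute [local instance] MvPolynomial.gradedAlgebra

noncomputable section

namespace GradedIdeal

/-- The grade of an ideal `I` of a commutative ring `R`: the supremum of the lengths of the
`R`-regular sequences contained in `I`. (For a proper ideal a weakly regular sequence contained
in it is regular; for the unit ideal the value is `⊤`, the usual convention.) -/
def grade {R : Type*} [CommRing R] (I : Ideal R) : ℕ∞ :=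
  ⨆ (rs : List R) (_ : RingTheory.Sequence.IsWeaklyRegular R rs ∧ ∀ r ∈ rs, r ∈ I),
    (rs.length : ℕ∞)

universe u

/-- A proper ideal `I` of a ring `R` is perfect if the projective dimension of `R ⧸ I` over `R`
equals the grade of `I`. -/
def IsPerfect {R : Type u} [CommRing R] (I : Ideal R) : Prop :=
  I ≠ ⊤ ∧
    CategoryTheory.projectiveDimension (ModuleCat.of R (R ⧸ I)) = ((grade I : ℕ∞) : WithBot ℕ∞)

variable {k : Type*} [Field k] {n : ℕ}

/-- The Hilbert function of `P ⧸ J`, where `P = k[x₁, …, xₙ]`: its value at `i` is the dimension of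
the image in `P ⧸ J` of the space of forms of degree `i`, that is `dim_k (P ⧸ J)_i` when `J` is
homogeneous. -/
def hilbertFunction (J : Ideal (MvPolynomial (Fin n) k)) (i : ℕ) : ℕ :=
  Module.finrank k
    ((homogeneousSubmodule (Fin n) k i).map (Ideal.Quotient.mkₐ k J).toLinearMap)

/-- The Hilbert series `∑ HF(i) tⁱ` of `P ⧸ J`. -/
def hilbertSeries (J : Ideal (MvPolynomial (Fin n) k)) : PowerSeries ℤ :=
  PowerSeries.mk fun i => (hilbertFunction J i : ℤ)

/-- The `h`-vector of `P ⧸ J` for an ideal `J` of height two, so that `P ⧸ J` has dimension `n - 2`: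
the coefficients of `h(t)`, where `HS(t) = h(t) / (1 - t)^(n - 2)`. -/
def hVector (J : Ideal (MvPolynomial (Fin n) k)) (j : ℕ) : ℤ :=
  PowerSeries.coeff j (hilbertSeries J * (1 - PowerSeries.X) ^ (n - 2))

/-- The first difference `Δh(j) = h(j) - h(j-1)`, with `h(-1) = 0`. -/
def diff (h : ℕ → ℤ) : ℕ → ℤ
  | 0 => h 0
  | j + 1 => h (j + 1) - h j

/-- The second difference `Δ²h(j) = h(j) - 2 h(j-1) + h(j-2)`, with `h(-1) = h(-2) = 0`. -/
def diff2 (h : ℕ → ℤ) : ℕ → ℤ := diff (diff h)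

/-- A minimal graded free resolution
`⋯ → F₂ → F₁ → F₀ → J → 0` of an ideal `J` of `P = k[x₁, …, xₙ]`,
with `F_i = ⨁_l P(-shift i l)` of finite rank. -/
structure MinimalGradedFreeResolution (J : Ideal (MvPolynomial (Fin n) k)) where
  /-- The rank of `F_i`. -/
  rank : ℕ → ℕ
  /-- The degrees of the basis elements of `F_i`. -/
  shift : ∀ i, Fin (rank i) → ℕ
  /-- The differential `F_{i+1} → F_i`. -/
  d : ∀ i, (Fin (rank (i + 1)) → MvPolynomial (Fin n) k) →ₗ[MvPolynomial (Fin n) k]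
    (Fin (rank i) → MvPolynomial (Fin n) k)
  /-- The augmentation `F₀ → J ⊆ P`. -/
  aug : (Fin (rank 0) → MvPolynomial (Fin n) k) →ₗ[MvPolynomial (Fin n) k] MvPolynomial (Fin n) k
  range_aug : LinearMap.range aug = J
  exact_aug : Function.Exact (d 0) aug
  exact_d : ∀ i, Function.Exact (d (i + 1)) (d i)
  /-- The augmentation is homogeneous of degree `0`. -/
  homogeneous_aug : ∀ l, (aug (Pi.single l 1)).IsHomogeneous (shift 0 l)
  /-- The differentials are homogeneous of degree `0`: every monomial of the `(m, l)` entry of the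
  matrix has degree `shift (i + 1) l - shift i m` (so the entry is `0` if this is negative). -/
  homogeneous_d : ∀ i l m, ∀ s ∈ (d i (Pi.single l 1) m).support,
    s.degree + shift i m = shift (i + 1) l
  /-- Minimality: `d(F_{i+1}) ⊆ (x₁, …, xₙ) F_i`. -/
  minimal : ∀ i l m, constantCoeff (d i (Pi.single l 1) m) = 0

/-- The graded Betti number `β_{ij}`: the multiplicity of `P(-j)` in `F_i`. -/
def MinimalGradedFreeResolution.betti {J : Ideal (MvPolynomial (Fin n) k)}
    (F : MinimalGradedFreeResolution J) (i j : ℕ) : ℕ :=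
  (Finset.univ.filter fun l => F.shift i l = j).card

/-- The minimal number of generators `ν(J)`. -/
abbrev nu (J : Ideal (MvPolynomial (Fin n) k)) : ℕ := Submodule.spanFinrank J

end GradedIdeal

end

/-! Since grade is at most height, perfection bounds the projective dimension of `P ⧸ J` by two.
Hence the kernel of `F.aug` is projective for every minimal graded free resolution `F`. Minimality
and Nakayama then make `F.d 0` injective (`injective_d_zero`), so `F` is `0 → F₁ → F₀ → J → 0`.

Counting dimensions in each degree and multiplying the Hilbert series by `(1 - t)^n` gives `Δ²h(j) =
[j = 0] + β₁ⱼ - β₀ⱼ` (`diff2_hVector`). So `β₀ⱼ ≥ |Δ²h(j)|` wherever `Δ²h(j) < 0`, and `∑ β₀ⱼ = rank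
F₀ = ν(J)` (`nu_eq_rank_zero`) yields the bound. Equality of the sums forces equality in every
degree, after which the same identity determines `β₁ⱼ`. -/

namespace GradedIdeal

/-! ### Graded pieces of free modules and homogeneous maps -/

section GradedPieces

variable {k σ : Type*} [Field k] {r : ℕ}

/-- The homogeneous elements of degree `d` of the free module `⨁ P(-s l)`. -/
def piece (s : Fin r → ℕ) (d : ℕ) : Submodule k (Fin r → MvPolynomial σ k) where
  carrier := {v | ∀ m, ∀ e ∈ (v m).support, e.degree + s m = d}
  zero_mem' := by simp
  add_mem' {v w} hv hw m e he := by
    classical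
    rcases Finset.mem_union.1 (MvPolynomial.support_add he) with h | h
    exacts [hv m e h, hw m e h]
  smul_mem' c v hv m e he := hv m e (MvPolynomial.support_smul he)

/-- The component of degree `d` of an element of the free module `⨁ P(-s l)`. -/
noncomputable def component (s : Fin r → ℕ) (d : ℕ) :
    (Fin r → MvPolynomial σ k) →ₗ[k] (Fin r → MvPolynomial σ k) :=
  LinearMap.pi fun m =>
    (if s m ≤ d then homogeneousComponent (d - s m) else 0) ∘ₗ LinearMap.proj m

lemma coeff_component (s : Fin r → ℕ) (d : ℕ) (v : Fin r → MvPolynomial σ k) (m : Fin r)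
    (e : σ →₀ ℕ) :
    coeff e (component s d v m) = if e.degree + s m = d then coeff e (v m) else 0 := by
  simp only [component, LinearMap.pi_apply, LinearMap.comp_apply, LinearMap.proj_apply]
  split_ifs with h1 h2 h2
  · rw [coeff_homogeneousComponent, if_pos (by omega)]
  · rw [coeff_homogeneousComponent, if_neg (by omega)]
  · omega
  · simp

lemma component_mem_piece (s : Fin r → ℕ) (d : ℕ) (v : Fin r → MvPolynomial σ k) :
    component s d v ∈ piece s d := by
  intro m e he
  rw [mem_support_iff, coeff_component] at he
  by_contra h
  simp [h] at he

lemma component_of_mem_piece {s : Fin r → ℕ} {d : ℕ} {v : Fin r → MvPolynomial σ k}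
    (hv : v ∈ piece s d) (d' : ℕ) : component s d' v = if d' = d then v else 0 := by
  ext m e
  rw [coeff_component]
  by_cases he : coeff e (v m) = 0
  · split_ifs <;> simp [he]
  · rw [hv m e (mem_support_iff.2 he)]
    simp only [eq_comm]
    split_ifs <;> simp

lemma exists_eq_sum_component (s : Fin r → ℕ) (v : Fin r → MvPolynomial σ k) :
    ∃ S : Finset ℕ, v = ∑ d ∈ S, component s d v := by
  classical
  refine ⟨Finset.univ.biUnion fun m => (v m).support.image fun e => e.degree + s m, ?_⟩
  ext m e
  simp only [Finset.sum_apply, coeff_sum, coeff_component, Finset.sum_ite_eq]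
  split_ifs with h
  · rfl
  · by_contra he
    exact h (Finset.mem_biUnion.2 ⟨m, Finset.mem_univ _,
      Finset.mem_image.2 ⟨e, mem_support_iff.2 he, rfl⟩⟩)

variable {r' : ℕ} {s : Fin r → ℕ} {t : Fin r' → ℕ}
  {φ : (Fin r → MvPolynomial σ k) →ₗ[MvPolynomial σ k] (Fin r' → MvPolynomial σ k)}

lemma map_mem_piece (hφ : ∀ l, φ (Pi.single l 1) ∈ piece t (s l)) {d : ℕ}
    {v : Fin r → MvPolynomial σ k} (hv : v ∈ piece s d) : φ v ∈ piece t d := by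
  classical
  rw [show v = ∑ l, v l • (Pi.single l 1 : Fin r → MvPolynomial σ k) from
    pi_eq_sum_univ' v, map_sum]
  refine Submodule.sum_mem _ fun l _ m e he => ?_
  rw [map_smul, Pi.smul_apply, smul_eq_mul] at he
  obtain ⟨a, ha, b, hb, rfl⟩ := Finset.mem_add.1 (support_mul _ _ he)
  have h1 := hv l a ha
  have h2 := hφ l m b hb
  rw [map_add]
  omega

lemma component_map (hφ : ∀ l, φ (Pi.single l 1) ∈ piece t (s l)) (d : ℕ)
    (v : Fin r → MvPolynomial σ k) : component t d (φ v) = φ (component s d v) := by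
  obtain ⟨S, hS⟩ := exists_eq_sum_component s v
  have h1 : component s d v = ∑ d' ∈ S, if d = d' then component s d' v else 0 := by
    conv_lhs => rw [hS, map_sum]
    exact Finset.sum_congr rfl fun d' _ => component_of_mem_piece (component_mem_piece s d' v) d
  have h2 : component t d (φ v) = ∑ d' ∈ S, if d = d' then φ (component s d' v) else 0 := by
    conv_lhs => rw [hS, map_sum, map_sum]
    exact Finset.sum_congr rfl fun d' _ =>
      component_of_mem_piece (map_mem_piece hφ (component_mem_piece s d' v)) d
  rw [h1, h2, map_sum]
  exact Finset.sum_congr rfl fun d' _ => by split_ifs <;> simp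

/-- A submodule of the free module `⨁ P(-s l)` is graded if it contains the components of its
elements. -/
def IsGraded (s : Fin r → ℕ) (N : Submodule (MvPolynomial σ k) (Fin r → MvPolynomial σ k)) :
    Prop :=
  ∀ v ∈ N, ∀ d, component s d v ∈ N

lemma isGraded_ker (hφ : ∀ l, φ (Pi.single l 1) ∈ piece t (s l)) :
    IsGraded s (LinearMap.ker φ) := by
  intro v hv d
  rw [LinearMap.mem_ker] at hv ⊢
  rw [← component_map hφ, hv, map_zero]

/-- A homogeneous map commutes with taking components, so any preimage of an element of degree `d`
may be replaced by its component of degree `d`. -/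
lemma map_piece (hφ : ∀ l, φ (Pi.single l 1) ∈ piece t (s l)) (d : ℕ) :
    (piece s d).map (φ.restrictScalars k) =
      piece t d ⊓ (LinearMap.range φ).restrictScalars k := by
  ext w
  constructor
  · rintro ⟨v, hv, rfl⟩
    exact ⟨map_mem_piece hφ hv, v, rfl⟩
  · rintro ⟨hw, v, rfl⟩
    refine ⟨component s d v, component_mem_piece s d v, ?_⟩
    rw [LinearMap.restrictScalars_apply, ← component_map hφ, component_of_mem_piece hw, if_pos rfl]

end GradedPieces

/-! ### Minimal homogeneous generators -/

section MinimalCover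

variable {k σ : Type*} [Field k] {r : ℕ}

lemma IsGraded.exists_homogeneous_generators [Finite σ] {s : Fin r → ℕ}
    {N : Submodule (MvPolynomial σ k) (Fin r → MvPolynomial σ k)} (hN : IsGraded s N) :
    ∃ (q : ℕ) (w : Fin q → Fin r → MvPolynomial σ k) (b : Fin q → ℕ),
      (∀ l, w l ∈ piece s (b l)) ∧ Submodule.span (MvPolynomial σ k) (Set.range w) = N := by
  classical
  obtain ⟨G, hG⟩ := IsNoetherian.noetherian N
  choose S hS using exists_eq_sum_component (k := k) (σ := σ) s
  let T : Finset ((Fin r → MvPolynomial σ k) × ℕ) := G.biUnion fun v => (S v).image fun d => (v, d)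
  let e := T.equivFin.symm
  refine ⟨T.card, fun l => component s (e l).1.2 (e l).1.1, fun l => (e l).1.2,
    fun l => component_mem_piece _ _ _, le_antisymm ?_ ?_⟩
  · rw [Submodule.span_le]
    rintro _ ⟨l, rfl⟩
    obtain ⟨v, hv, hl⟩ := Finset.mem_biUnion.1 (e l).2
    obtain ⟨d, -, hl⟩ := Finset.mem_image.1 hl
    refine hN _ ?_ _
    rw [← hl, ← hG]
    exact Submodule.subset_span hv
  · rw [← hG, Submodule.span_le]
    intro v hv
    rw [SetLike.mem_coe, hS v]
    refine Submodule.sum_mem _ fun d hd => Submodule.subset_span ?_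
    have hT : (v, d) ∈ T := Finset.mem_biUnion.2 ⟨v, hv, Finset.mem_image.2 ⟨d, hd, rfl⟩⟩
    refine ⟨e.symm ⟨(v, d), hT⟩, ?_⟩
    simp

/-- Take the least possible number of homogeneous generators: a relation with a nonzero constant
term in some coordinate would express one generator through the others. -/
lemma IsGraded.exists_minimal_cover [Finite σ] {s : Fin r → ℕ}
    {N : Submodule (MvPolynomial σ k) (Fin r → MvPolynomial σ k)} (hN : IsGraded s N) :
    ∃ (q : ℕ) (b : Fin q → ℕ)
      (φ : (Fin q → MvPolynomial σ k) →ₗ[MvPolynomial σ k] (Fin r → MvPolynomial σ k)),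
      LinearMap.range φ = N ∧ (∀ l, φ (Pi.single l 1) ∈ piece s (b l)) ∧
      ∀ u ∈ LinearMap.ker φ, ∀ m, constantCoeff (u m) = 0 := by
  classical
  have hex := hN.exists_homogeneous_generators
  obtain ⟨w, b, hw, hspan⟩ := Nat.find_spec hex
  have hmin := fun q => Nat.find_min hex (m := q)
  generalize Nat.find hex = q at *
  have hφ : ∀ l, Fintype.linearCombination (MvPolynomial σ k) w (Pi.single l 1) ∈
      piece s (b l) := by simpa using hw
  refine ⟨q, b, Fintype.linearCombination _ w, ?_, hφ, fun u hu m => ?_⟩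
  · rw [Fintype.range_linearCombination, hspan]
  by_contra hc
  obtain ⟨q, rfl⟩ : ∃ q', q = q' + 1 := ⟨q - 1, by have := m.2; omega⟩
  refine hmin q (Nat.lt_succ_self q) ⟨w ∘ m.succAbove, b ∘ m.succAbove, fun l => hw _, ?_⟩
  -- The component of the relation in degree `b m` is again a relation, and its `m`-th coordinate is
  -- the nonzero scalar `constantCoeff (u m)`.
  have hu' := isGraded_ker hφ u hu (b m)
  have hm : component b (b m) u m = C (constantCoeff (u m)) := by
    ext e
    rw [coeff_component, coeff_C, constantCoeff_eq]
    by_cases he : e = 0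
    · simp [he]
    · rw [if_neg (by simpa [Finsupp.degree_eq_zero_iff] using he), if_neg (Ne.symm he)]
  rw [← hspan]
  refine le_antisymm (Submodule.span_mono (Set.range_comp_subset_range _ _)) ?_
  rw [Submodule.span_le]
  rintro _ ⟨l, rfl⟩
  by_cases hl : l = m
  · subst hl
    rw [LinearMap.mem_ker, Fintype.linearCombination_apply, Fin.sum_univ_succAbove _ l, hm] at hu'
    have : w l = -((C (constantCoeff (u l))⁻¹ : MvPolynomial σ k) •
        ∑ i, component b (b l) u (l.succAbove i) • w (l.succAbove i)) := by
      rw [← eq_neg_iff_add_eq_zero] at hu'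
      rw [← smul_neg, ← hu', smul_smul, ← C_mul, inv_mul_cancel₀ hc, C_1, one_smul]
    rw [SetLike.mem_coe, this]
    exact neg_mem (Submodule.smul_mem _ _ (Submodule.sum_mem _ fun i _ =>
      Submodule.smul_mem _ _ (Submodule.subset_span ⟨i, rfl⟩)))
  · obtain ⟨i, rfl⟩ := Fin.exists_succAbove_eq hl
    exact Submodule.subset_span ⟨i, rfl⟩

end MinimalCover

/-! ### Existence of minimal graded free resolutions -/

section Existence

variable {k : Type*} [Field k] {n : ℕ}

/-- A graded submodule of a graded free module of finite rank. -/
structure GradedSubmodule (k : Type*) [Field k] (n : ℕ) where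
  /-- The rank of the free module. -/
  rank : ℕ
  /-- The degrees of the basis elements of the free module. -/
  shift : Fin rank → ℕ
  /-- The submodule. -/
  carrier : Submodule (MvPolynomial (Fin n) k) (Fin rank → MvPolynomial (Fin n) k)
  isGraded : IsGraded shift carrier

namespace GradedSubmodule

variable (N : GradedSubmodule k n)

/-- The number of elements of a minimal set of homogeneous generators. -/
noncomputable def coverRank : ℕ := N.isGraded.exists_minimal_cover.choose

/-- The degrees of the elements of a minimal set of homogeneous generators. -/
noncomputable def coverShift : Fin N.coverRank → ℕ :=
  N.isGraded.exists_minimal_cover.choose_spec.choose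

/-- The map from a graded free module given by a minimal set of homogeneous generators. -/
noncomputable def cover : (Fin N.coverRank → MvPolynomial (Fin n) k) →ₗ[MvPolynomial (Fin n) k]
    (Fin N.rank → MvPolynomial (Fin n) k) :=
  N.isGraded.exists_minimal_cover.choose_spec.choose_spec.choose

lemma cover_spec : LinearMap.range N.cover = N.carrier ∧
    (∀ l, N.cover (Pi.single l 1) ∈ piece N.shift (N.coverShift l)) ∧
    ∀ u ∈ LinearMap.ker N.cover, ∀ m, constantCoeff (u m) = 0 :=
  N.isGraded.exists_minimal_cover.choose_spec.choose_spec.choose_spec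

/-- The syzygy module of a minimal set of homogeneous generators. -/
noncomputable def syzygy : GradedSubmodule k n where
  rank := N.coverRank
  shift := N.coverShift
  carrier := LinearMap.ker N.cover
  isGraded := isGraded_ker N.cover_spec.2.1

/-- The iterated syzygy modules. -/
noncomputable def syzygies : ℕ → GradedSubmodule k n
  | 0 => N
  | i + 1 => (syzygies i).syzygy

end GradedSubmodule

/-- A homogeneous ideal as a graded submodule of the free module of rank one. -/
noncomputable def idealGradedSubmodule (J : Ideal (MvPolynomial (Fin n) k))
    (hJ : J.IsHomogeneous (homogeneousSubmodule (Fin n) k)) : GradedSubmodule k n where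
  rank := 1
  shift := 0
  carrier := Submodule.comap (LinearMap.proj 0) J
  isGraded v hv d := by
    simpa [component] using homogeneousComponent_mem_of_mem hJ hv d

/-- A homogeneous ideal of a polynomial ring has a minimal graded free resolution. -/
theorem nonempty_minimalGradedFreeResolution {J : Ideal (MvPolynomial (Fin n) k)}
    (hJ : J.IsHomogeneous (homogeneousSubmodule (Fin n) k)) :
    Nonempty (MinimalGradedFreeResolution J) := by
  let N := (idealGradedSubmodule J hJ).syzygies
  let π : (Fin 1 → MvPolynomial (Fin n) k) →ₗ[MvPolynomial (Fin n) k] MvPolynomial (Fin n) k :=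
    LinearMap.proj 0
  have hker (i) (y : Fin (N i).coverRank → MvPolynomial (Fin n) k) :
      (N i).cover y = 0 ↔ y ∈ Set.range (N (i + 1)).cover :=
    (SetLike.ext_iff.1 (N (i + 1)).cover_spec.1 y).symm
  refine ⟨⟨fun i => (N i).coverRank, fun i => (N i).coverShift, fun i => (N (i + 1)).cover,
    π ∘ₗ (N 0).cover, ?_, fun y => Iff.trans ?_ (hker 0 y), fun i => hker (i + 1), ?_,
    fun i l m e he => (N (i + 1)).cover_spec.2.1 l m e he,
    fun i l m => (N i).cover_spec.2.2 _ ((hker i _).2 ⟨_, rfl⟩) m⟩⟩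
  · refine (LinearMap.range_comp _ π).trans ?_
    refine (congrArg (Submodule.map π) (N 0).cover_spec.1).trans ?_
    exact Submodule.map_comap_eq_of_surjective (fun p => ⟨fun _ : Fin 1 => p, rfl⟩) J
  · refine ⟨fun h => funext fun i : Fin 1 => ?_, fun h => congrFun h (0 : Fin 1)⟩
    rw [Subsingleton.elim i 0]
    exact h
  · intro l
    rw [← mem_homogeneousSubmodule, homogeneousSubmodule_eq_finsupp_supported]
    intro e he
    exact (N 0).cover_spec.2.1 l (0 : Fin 1) e he

end Existence

/-! ### Grade, height and projective dimension -/

section Grade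

universe u

/-- The length of a weakly regular sequence in an ideal is at most the height of the ideal. -/
lemma length_le_height {R : Type*} [CommRing R] [IsNoetherianRing R] {I : Ideal R}
    {rs : List R} (hreg : RingTheory.Sequence.IsWeaklyRegular R rs)
    (hmem : ∀ r ∈ rs, r ∈ I) : (rs.length : ℕ∞) ≤ I.height := by
  rw [Ideal.height_eq_inf_minimalPrimes]
  refine le_iInf₂ fun p hp => ?_
  have := hp.1.1
  -- In the local ring at `p`, of dimension `p.height`, dividing by a regular sequence lowers the
  -- dimension by exactly its length.
  have hreg' := hreg.isRegular_of_isLocalization_of_mem (Localization.AtPrime p) p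
    fun r hr => hp.1.2 (hmem r hr)
  have h := ringKrullDim_add_length_eq_ringKrullDim_of_isRegular _ hreg'
  rw [IsLocalization.AtPrime.ringKrullDim_eq_height p (Localization.AtPrime p),
    List.length_map] at h
  have hne : Ideal.ofList (rs.map (algebraMap R (Localization.AtPrime p))) ≠ ⊤ := by
    simpa using hreg'.2.symm
  have := Ideal.Quotient.nontrivial_iff.2 hne
  rw [← WithBot.coe_le_coe, ← h]
  exact le_add_of_nonneg_left ringKrullDim_nonneg_of_nontrivial

lemma grade_le_height {R : Type*} [CommRing R] [IsNoetherianRing R] {I : Ideal R} :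
    grade I ≤ I.height :=
  iSup₂_le fun _ h => length_le_height h.1 h.2

open CategoryTheory in
/-- If `R ⧸ I` has projective dimension at most two, the kernel of a map from a projective module
onto `I` is projective. -/
lemma projective_ker_of_projectiveDimension_le_two {R : Type u} [CommRing R] {I : Ideal R}
    (hI : projectiveDimension (ModuleCat.of R (R ⧸ I)) ≤ 2) {F : Type u} [AddCommGroup F]
    [Module R F] [Module.Projective R F] (f : F →ₗ[R] R) (hf : LinearMap.range f = I) :
    Module.Projective R (LinearMap.ker f) := by
  have h3 : HasProjectiveDimensionLT (ModuleCat.of R (R ⧸ I)) 3 :=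
    (projectiveDimension_le_iff _ 2).1 hI
  subst hf
  -- Dimension shifting along `0 → I → R → R ⧸ I → 0` and `0 → ker f → F → I → 0`.
  let S₁ : ShortComplex (ModuleCat.{u} R) :=
    ShortComplex.mk (ModuleCat.ofHom (LinearMap.range f).subtype)
      (ModuleCat.ofHom (Submodule.mkQ (LinearMap.range f)))
      (by ext x; exact (Submodule.Quotient.mk_eq_zero _).2 x.2)
  let S₂ : ShortComplex (ModuleCat.{u} R) :=
    ShortComplex.mk (ModuleCat.ofHom (LinearMap.ker f).subtype)
      (ModuleCat.ofHom f.rangeRestrict) (by ext x; exact x.2)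
  have hS₁ : S₁.ShortExact :=
    ModuleCat.shortComplex_shortExact S₁ (LinearMap.exact_subtype_mkQ _)
      (Submodule.injective_subtype _) (Submodule.mkQ_surjective _)
  have hS₂ : S₂.ShortExact :=
    ModuleCat.shortComplex_shortExact S₂
      (LinearMap.exact_iff.2 ((LinearMap.ker_rangeRestrict f).trans (Submodule.range_subtype _).symm))
      (Submodule.injective_subtype _) f.surjective_rangeRestrict
  have hp1 : Projective S₁.X₂ := (IsProjective.iff_projective R).1 inferInstance
  have hp2 : Projective S₂.X₂ := (IsProjective.iff_projective F).1 ‹_›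
  have h2 : HasProjectiveDimensionLT S₁.X₁ 2 := (hS₁.hasProjectiveDimensionLT_X₃_iff 1 hp1).1 h3
  have h1 : HasProjectiveDimensionLT S₂.X₁ 1 := (hS₂.hasProjectiveDimensionLT_X₃_iff 0 hp2).1 h2
  rw [← projective_iff_hasProjectiveDimensionLT_one] at h1
  exact (IsProjective.iff_projective _).2 h1

end Grade

/-! ### Nakayama and injectivity -/

section Projective

variable {k σ : Type*} [Field k] {r q : ℕ}

lemma constantCoeff_map_eq_zero
    {φ : (Fin r → MvPolynomial σ k) →ₗ[MvPolynomial σ k] (Fin q → MvPolynomial σ k)}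
    (hφ : ∀ l m, constantCoeff (φ (Pi.single l 1) m) = 0) (v : Fin r → MvPolynomial σ k)
    (m : Fin q) : constantCoeff (φ v m) = 0 := by
  rw [show v = ∑ l, v l • (Pi.single l 1 : Fin r → MvPolynomial σ k) from
    pi_eq_sum_univ' v, map_sum]
  simp [hφ]

/-- A map of free modules with projective image is injective if its kernel consists of elements
whose coordinates have no constant term. -/
lemma injective_of_projective_range [Finite σ]
    {φ : (Fin r → MvPolynomial σ k) →ₗ[MvPolynomial σ k] (Fin q → MvPolynomial σ k)}
    (hproj : Module.Projective (MvPolynomial σ k) (LinearMap.range φ))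
    (hker : ∀ u ∈ LinearMap.ker φ, ∀ m, constantCoeff (u m) = 0) : Function.Injective φ := by
  obtain ⟨τ, hτ⟩ := Module.projective_lifting_property φ.rangeRestrict LinearMap.id
    φ.surjective_rangeRestrict
  -- `τ` splits `φ` onto its image, so `ψ` is a projection onto `ker φ`.
  let ψ := LinearMap.id - τ ∘ₗ φ.rangeRestrict
  have hψ (v) : ψ v ∈ LinearMap.ker φ := by
    have h := congrArg Subtype.val (LinearMap.congr_fun hτ (φ.rangeRestrict v))
    change φ (τ (φ.rangeRestrict v)) = φ v at h
    rw [LinearMap.mem_ker, LinearMap.sub_apply, map_sub, LinearMap.comp_apply, h]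
    exact sub_self _
  have hle : LinearMap.ker φ ≤ RingHom.ker (constantCoeff (R := k) (σ := σ)) • LinearMap.ker φ := by
    intro u hu
    have hu' : ψ u = u := by
      have : φ.rangeRestrict u = 0 := Subtype.ext hu
      simp [ψ, this]
    rw [← hu', show u = ∑ l, u l • (Pi.single l 1 : Fin r → MvPolynomial σ k) from
      pi_eq_sum_univ' u, map_sum]
    refine Submodule.sum_mem _ fun l _ => ?_
    rw [map_smul]
    exact Submodule.smul_mem_smul (hker u hu l) (hψ _)
  -- The ring is not local, so Nakayama only provides an `a` with constant term `1` killing the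
  -- kernel; this suffices because the free module is torsion-free.
  obtain ⟨a, ha, ha'⟩ := Submodule.exists_sub_one_mem_and_smul_eq_zero_of_fg_of_le_smul _ _
    (IsNoetherian.noetherian _) hle
  have ha0 : a ≠ 0 := by
    rintro rfl
    simp [RingHom.mem_ker] at ha
  rw [← LinearMap.ker_eq_bot, Submodule.eq_bot_iff]
  exact fun u hu => (smul_eq_zero.1 (ha' u hu)).resolve_left ha0

end Projective

/-! ### Length and first rank of a minimal resolution -/

namespace MinimalGradedFreeResolution

universe u

variable {k : Type u} [Field k] {n : ℕ} {J : Ideal (MvPolynomial (Fin n) k)}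
  (F : MinimalGradedFreeResolution J)

lemma constantCoeff_of_mem_ker_aug {u} (hu : u ∈ LinearMap.ker F.aug) (m) :
    constantCoeff (u m) = 0 := by
  obtain ⟨v, rfl⟩ := (F.exact_aug u).1 hu
  exact constantCoeff_map_eq_zero (F.minimal 0) v m

/-- Exactness would make `F.d (i + 1)` surjective, while minimality keeps basis vectors out of its
image. -/
lemma rank_succ_eq_zero_of_d_eq_zero {i : ℕ} (h : F.d i = 0) : F.rank (i + 1) = 0 := by
  by_contra hr
  let l : Fin (F.rank (i + 1)) := ⟨0, Nat.pos_of_ne_zero hr⟩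
  obtain ⟨v, hv⟩ := (F.exact_d i (Pi.single l 1)).1 (by simp [h])
  have := constantCoeff_map_eq_zero (F.minimal (i + 1)) v l
  simp [hv] at this

lemma injective_d_zero
    (hJ : CategoryTheory.projectiveDimension
      (ModuleCat.of (MvPolynomial (Fin n) k) (MvPolynomial (Fin n) k ⧸ J)) ≤ 2) :
    Function.Injective (F.d 0) := by
  refine injective_of_projective_range ?_ fun u hu m => ?_
  · rw [← LinearMap.exact_iff.1 F.exact_aug]
    exact projective_ker_of_projectiveDimension_le_two hJ F.aug F.range_aug
  · obtain ⟨v, rfl⟩ := (F.exact_d 0 u).1 hu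
    exact constantCoeff_map_eq_zero (F.minimal 1) v m

lemma rank_eq_zero_of_injective (hF : Function.Injective (F.d 0)) (i : ℕ) :
    F.rank (i + 2) = 0 := by
  induction i with
  | zero =>
    refine F.rank_succ_eq_zero_of_d_eq_zero (LinearMap.ext fun v => hF ?_)
    rw [LinearMap.zero_apply, map_zero]
    exact (F.exact_d 0 _).2 ⟨v, rfl⟩
  | succ i ih =>
    have : IsEmpty (Fin (F.rank (i + 2))) := by rw [ih]; infer_instance
    exact F.rank_succ_eq_zero_of_d_eq_zero (LinearMap.ext fun v => Subsingleton.elim _ _)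

/-- For the lower bound, lift an arbitrary, possibly inhomogeneous, generating set of least size to
`F₀`. The lifts span `F₀` modulo `ker F.aug`, whose elements have no constant terms, so their
constant terms span `k ^ rank F₀`. -/
lemma nu_eq_rank_zero : nu J = F.rank 0 := by
  apply le_antisymm
  · calc nu J = (Submodule.map F.aug ⊤).spanFinrank := by rw [Submodule.map_top, F.range_aug]
      _ ≤ (⊤ : Submodule (MvPolynomial (Fin n) k) (Fin (F.rank 0) → _)).spanFinrank :=
        Submodule.spanFinrank_map_le_of_fg _ (IsNoetherian.noetherian _)
      _ = F.rank 0 := by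
        rw [← Module.finrank_eq_spanFinrank_of_free, Module.finrank_fin_fun]
  · obtain ⟨S, hS, hspan⟩ := Submodule.FG.exists_span_finset_card_eq_spanFinrank
      (IsNoetherian.noetherian J)
    have hSJ : ∀ x : S, ∃ y, F.aug y = x := fun x => by
      have : (x : MvPolynomial (Fin n) k) ∈ LinearMap.range F.aug := by
        rw [F.range_aug]
        exact hspan ▸ Submodule.subset_span x.2
      exact this
    choose y hy using hSJ
    let Y := Submodule.span (MvPolynomial (Fin n) k) (Set.range y)
    have hY (v) : ∃ w ∈ Y, v - w ∈ LinearMap.ker F.aug := by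
      have hmap : Submodule.map F.aug Y = J := by
        rw [Submodule.map_span, ← Set.range_comp]
        refine Eq.trans ?_ hspan
        congr 1
        ext x
        simp [hy]
      have : F.aug v ∈ Submodule.map F.aug Y := by
        rw [hmap]
        exact F.range_aug.le ⟨v, rfl⟩
      obtain ⟨w, hw, hwv⟩ := this
      exact ⟨w, hw, by rw [LinearMap.mem_ker, map_sub, hwv, sub_self]⟩
    let π (v : Fin (F.rank 0) → MvPolynomial (Fin n) k) (m) : k := constantCoeff (v m)
    have hπY : ∀ w ∈ Y, π w ∈ Submodule.span k (Set.range (π ∘ y)) := by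
      intro w hw
      induction hw using Submodule.span_induction with
      | mem x hx =>
        obtain ⟨x, rfl⟩ := hx
        exact Submodule.subset_span ⟨x, rfl⟩
      | zero =>
        convert Submodule.zero_mem _
        ext; simp [π]
      | add a b _ _ ha hb =>
        convert Submodule.add_mem _ ha hb
        ext; simp [π]
      | smul c a _ ha =>
        convert Submodule.smul_mem _ (constantCoeff c) ha
        ext; simp [π]
    have htop : Submodule.span k (Set.range (π ∘ y)) = ⊤ := by
      rw [eq_top_iff]
      intro c _
      obtain ⟨w, hw, hcw⟩ := hY (fun m => C (c m))
      convert hπY w hw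
      ext m
      have := F.constantCoeff_of_mem_ker_aug hcw m
      simpa [sub_eq_zero] using this
    have := finrank_range_le_card (R := k) (π ∘ y)
    rw [Set.finrank, htop, finrank_top] at this
    rw [nu, ← hS]
    simpa using this

end MinimalGradedFreeResolution

/-! ### Dimensions of graded pieces -/

section Dimension

variable {k : Type*} [Field k]

lemma finrank_map_add_finrank_inf_ker {V W : Type*} [AddCommGroup V] [Module k V]
    [AddCommGroup W] [Module k W] (f : V →ₗ[k] W) (p : Submodule k V) [FiniteDimensional k p] :
    Module.finrank k (p.map f) + Module.finrank k (p ⊓ LinearMap.ker f : Submodule k V) =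
      Module.finrank k p := by
  rw [← LinearMap.finrank_range_add_finrank_ker (f.domRestrict p), LinearMap.range_domRestrict,
    LinearMap.ker_domRestrict, ← Submodule.map_comap_subtype]
  rw [Submodule.finrank_map_subtype_eq]

variable {n : ℕ}

/-- The graded piece of a graded free module as a product of graded pieces of the ring. -/
def pieceEquiv {σ : Type*} {r : ℕ} (s : Fin r → ℕ) (d : ℕ) :
    (piece s d : Submodule k (Fin r → MvPolynomial σ k)) ≃ₗ[k]
      (Π l, (if s l ≤ d then homogeneousSubmodule σ k (d - s l) else ⊥ :
        Submodule k (MvPolynomial σ k))) where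
  toFun v l := ⟨v.1 l, by
    split_ifs with h
    · rw [homogeneousSubmodule_eq_finsupp_supported]
      intro e he
      have := v.2 l e he
      exact (by omega : e.degree = d - s l)
    · rw [Submodule.mem_bot, ← support_eq_empty, Finset.eq_empty_iff_forall_notMem]
      intro e he
      have := v.2 l e he
      omega⟩
  map_add' _ _ := rfl
  map_smul' _ _ := rfl
  invFun w := ⟨fun l => (w l).1, fun l e he => by
    change e ∈ (w l).1.support at he
    have hw := (w l).2
    generalize (w l).1 = p at he hw
    split_ifs at hw with h
    · rw [homogeneousSubmodule_eq_finsupp_supported] at hw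
      have : e.degree = d - s l := hw he
      omega
    · rw [Submodule.mem_bot] at hw
      simp [hw] at he⟩
  left_inv _ := rfl
  right_inv _ := rfl

instance (d : ℕ) : FiniteDimensional k (homogeneousSubmodule (Fin n) k d) :=
  Module.Finite.iff_fg.2 (homogeneousSubmodule_fg _ _ d)

instance (s d : ℕ) : FiniteDimensional k (if s ≤ d then homogeneousSubmodule (Fin n) k (d - s)
    else ⊥ : Submodule k (MvPolynomial (Fin n) k)) := by
  refine Module.Finite.iff_fg.2 ?_
  split_ifs
  exacts [homogeneousSubmodule_fg _ _ _, Submodule.fg_bot]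

instance {r : ℕ} (s : Fin r → ℕ) (d : ℕ) :
    FiniteDimensional k (piece s d : Submodule k (Fin r → MvPolynomial (Fin n) k)) :=
  Module.Finite.equiv (pieceEquiv s d).symm

lemma finrank_piece {r : ℕ} (s : Fin r → ℕ) (d : ℕ) :
    Module.finrank k (piece s d : Submodule k (Fin r → MvPolynomial (Fin n) k)) =
      ∑ l, if s l ≤ d then Module.finrank k (homogeneousSubmodule (Fin n) k (d - s l)) else 0 := by
  rw [(pieceEquiv s d).finrank_eq, Module.finrank_pi_fintype]
  refine Finset.sum_congr rfl fun l _ => ?_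
  split_ifs with h
  · rw [if_pos h]
  · rw [if_neg h, finrank_bot]

lemma finrank_homogeneousSubmodule (d : ℕ) :
    Module.finrank k (homogeneousSubmodule (Fin n) k d) = (n + d - 1).choose d := by
  have h : {e : Fin n →₀ ℕ | e.degree = d} =
      ((Finset.univ.finsuppAntidiag d : Finset (Fin n →₀ ℕ)) : Set (Fin n →₀ ℕ)) := by
    ext e
    simp [Finsupp.degree_eq_sum]
  rw [homogeneousSubmodule_eq_finsupp_supported]
  refine (Module.finrank_eq_nat_card_basis
    (basisRestrictSupport k {e : Fin n →₀ ℕ | e.degree = d})).trans ?_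
  rw [h]
  refine (Nat.card_eq_fintype_card.trans (Fintype.card_coe _)).trans ?_
  simp [Finset.card_finsuppAntidiag_nat_eq_choose]

/-- The Hilbert series of the polynomial ring. -/
lemma hilbertSeries_polynomialRing (hn : 0 < n) :
    (PowerSeries.mk fun d => (Module.finrank k (homogeneousSubmodule (Fin n) k d) : ℤ)) *
      (1 - PowerSeries.X) ^ n = 1 := by
  obtain ⟨m, rfl⟩ : ∃ m, n = m + 1 := ⟨n - 1, by omega⟩
  refine Eq.trans ?_ (PowerSeries.mk_add_choose_mul_one_sub_pow_eq_one ℤ m)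
  congr 1
  ext d
  rw [PowerSeries.coeff_mk, PowerSeries.coeff_mk, finrank_homogeneousSubmodule,
    show m + 1 + d - 1 = m + d by omega, Nat.choose_symm_add]

end Dimension

/-! ### Differences as multiplication by powers of `1 - t` -/

section SecondDifference

lemma mk_diff (h : ℕ → ℤ) :
    PowerSeries.mk (diff h) = PowerSeries.mk h * (1 - PowerSeries.X) := by
  ext j
  rcases j with _ | j
  · simp [diff, mul_sub]
  · simp [diff, mul_sub, PowerSeries.coeff_succ_mul_X]

lemma mk_diff2 (h : ℕ → ℤ) :
    PowerSeries.mk (diff2 h) = PowerSeries.mk h * (1 - PowerSeries.X) ^ 2 := by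
  rw [diff2, mk_diff, mk_diff]
  ring

lemma mk_hVector {k : Type*} [Field k] {n : ℕ} (J : Ideal (MvPolynomial (Fin n) k)) :
    PowerSeries.mk (hVector J) = hilbertSeries J * (1 - PowerSeries.X) ^ (n - 2) := by
  ext j
  rw [PowerSeries.coeff_mk, hVector]

end SecondDifference

/-! ### Hilbert series and graded Betti numbers -/

namespace MinimalGradedFreeResolution

variable {k : Type*} [Field k] {n : ℕ} {J : Ideal (MvPolynomial (Fin n) k)}
  (F : MinimalGradedFreeResolution J)

lemma map_aug_piece (d : ℕ) :
    (piece (F.shift 0) d).map (F.aug.restrictScalars k) =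
      homogeneousSubmodule (Fin n) k d ⊓ J.restrictScalars k := by
  -- The target `P` is viewed as a free module of rank one with shift `0`, so that `map_piece`
  -- applies.
  let φ : (Fin (F.rank 0) → MvPolynomial (Fin n) k) →ₗ[MvPolynomial (Fin n) k]
      (Fin 1 → MvPolynomial (Fin n) k) := LinearMap.pi fun _ => F.aug
  have hpiece (d) (w : Fin 1 → MvPolynomial (Fin n) k) :
      w ∈ piece (k := k) 0 d ↔ w 0 ∈ homogeneousSubmodule (Fin n) k d := by
    rw [homogeneousSubmodule_eq_finsupp_supported]
    constructor
    · exact fun h e he => h 0 e he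
    · intro h m e he
      rw [Subsingleton.elim m 0] at he
      exact h he
  have hφ (l) : φ (Pi.single l 1) ∈ piece (k := k) 0 (F.shift 0 l) := by
    rw [hpiece]
    exact F.homogeneous_aug l
  have hmap := map_piece hφ d
  ext x
  constructor
  · rintro ⟨v, hv, rfl⟩
    refine ⟨?_, F.range_aug.le ⟨v, rfl⟩⟩
    exact (hpiece d _).1 (hmap.le ⟨v, hv, rfl⟩).1
  · rintro ⟨hx, hxJ⟩
    obtain ⟨y, hy⟩ := F.range_aug.ge hxJ
    obtain ⟨v, hv, hvx⟩ := hmap.ge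
      (Submodule.mem_inf.2 ⟨(hpiece d fun _ => x).2 hx, y, funext fun _ => hy⟩)
    exact ⟨v, hv, congrFun hvx 0⟩

/-- The Euler characteristic of `0 → F₁ → F₀ → P → P ⧸ J → 0` in degree `d`. -/
lemma finrank_piece_zero_add_hilbertFunction (hF : Function.Injective (F.d 0)) (d : ℕ) :
    Module.finrank k (piece (F.shift 0) d :
        Submodule k (Fin (F.rank 0) → MvPolynomial (Fin n) k)) + hilbertFunction J d =
      Module.finrank k (homogeneousSubmodule (Fin n) k d) +
        Module.finrank k (piece (F.shift 1) d :
          Submodule k (Fin (F.rank 1) → MvPolynomial (Fin n) k)) := by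
  have h1 := finrank_map_add_finrank_inf_ker (Ideal.Quotient.mkₐ k J).toLinearMap
    (homogeneousSubmodule (Fin n) k d)
  have h2 := finrank_map_add_finrank_inf_ker (F.aug.restrictScalars k) (piece (F.shift 0) d)
  have h3 : Module.finrank k (piece (F.shift 1) d :
      Submodule k (Fin (F.rank 1) → MvPolynomial (Fin n) k)) = _ :=
    (Submodule.equivMapOfInjective ((F.d 0).restrictScalars k) hF
    (piece (F.shift 1) d)).finrank_eq
  rw [map_piece fun l m => F.homogeneous_d 0 l m] at h3
  have h4 : LinearMap.ker (Ideal.Quotient.mkₐ k J).toLinearMap = J.restrictScalars k := by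
    ext x
    simp [Ideal.Quotient.eq_zero_iff_mem]
  have h5 : LinearMap.ker (F.aug.restrictScalars k) =
      (LinearMap.range (F.d 0)).restrictScalars k := by
    rw [← LinearMap.exact_iff.1 F.exact_aug]
    rfl
  rw [h4] at h1
  rw [h5, ← h3, F.map_aug_piece] at h2
  rw [hilbertFunction]
  omega

lemma diff2_hVector (hn : 2 ≤ n) (hF : Function.Injective (F.d 0)) (j : ℕ) :
    diff2 (hVector J) j + F.betti 0 j = (if j = 0 then 1 else 0) + F.betti 1 j := by
  let H : PowerSeries ℤ :=
    PowerSeries.mk fun d => (Module.finrank k (homogeneousSubmodule (Fin n) k d) : ℤ)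
  let B (i : ℕ) : PowerSeries ℤ := PowerSeries.mk fun j => (F.betti i j : ℤ)
  have hB (i) : B i * H = PowerSeries.mk fun d => (Module.finrank k (piece (F.shift i) d :
      Submodule k (Fin (F.rank i) → MvPolynomial (Fin n) k)) : ℤ) := by
    have : B i = ∑ l, PowerSeries.X ^ F.shift i l := by
      ext j
      simp [B, betti, PowerSeries.coeff_X_pow, Finset.sum_boole, eq_comm]
    ext d
    simp [this, Finset.sum_mul, finrank_piece, H, PowerSeries.coeff_X_pow_mul']
  have h1 : B 0 * H + hilbertSeries J = H + B 1 * H := by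
    ext d
    rw [hB, hB]
    simpa [H, hilbertSeries] using mod_cast F.finrank_piece_zero_add_hilbertFunction hF d
  have h2 : H * (1 - PowerSeries.X) ^ n = 1 := hilbertSeries_polynomialRing (by omega)
  have h3 : PowerSeries.mk (diff2 (hVector J)) = hilbertSeries J * (1 - PowerSeries.X) ^ n := by
    rw [mk_diff2, mk_hVector, mul_assoc, ← pow_add, Nat.sub_add_cancel hn]
  have h4 : PowerSeries.mk (diff2 (hVector J)) + B 0 = 1 + B 1 := by
    rw [h3]
    linear_combination (1 - PowerSeries.X) ^ n * h1 + (1 + B 1 - B 0) * h2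
  simpa [B, PowerSeries.coeff_one] using congrArg (PowerSeries.coeff j) h4

end MinimalGradedFreeResolution

/-! ### Numerical comparison and remaining bounds -/

/-- The numerical part of the comparison of the graded Betti numbers with the second differences
of the `h`-vector. -/
lemma finsum_natAbs_le_and_eq {D : ℕ → ℤ} {b₀ b₁ : ℕ → ℕ} {T : Finset ℕ} {r : ℕ}
    (hD : ∀ j, D j + b₀ j = (if j = 0 then 1 else 0) + b₁ j) (h₁ : b₁ 0 = 0)
    (hT : ∀ j ∉ T, b₀ j = 0) (hr : ∑ j ∈ T, b₀ j = r) :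
    {i | D i ≤ -1}.Finite ∧ ∑ᶠ i ∈ {i | D i ≤ -1}, (D i).natAbs ≤ r ∧
    (r = ∑ᶠ i ∈ {i | D i ≤ -1}, (D i).natAbs →
      (∀ j, b₀ j = if D j ≤ -1 then (D j).natAbs else 0) ∧
      ∀ j, b₁ j = if 1 ≤ j ∧ 1 ≤ D j then (D j).natAbs else 0) := by
  have hsub : {i | D i ≤ -1} = (T.filter fun i => D i ≤ -1 : Finset ℕ) := by
    ext i
    rw [Finset.coe_filter, Set.mem_ofPred_eq, Set.mem_ofPred_eq, iff_and_self]
    intro hi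
    by_contra hiT
    have h1 := hD i
    have h2 := hT i hiT
    split_ifs at h1 <;> omega
  have hle (j) : (if D j ≤ -1 then (D j).natAbs else 0) ≤ b₀ j := by
    have := hD j
    split_ifs at this ⊢ <;> omega
  have hsum : ∑ᶠ i ∈ {i | D i ≤ -1}, (D i).natAbs =
      ∑ j ∈ T, if D j ≤ -1 then (D j).natAbs else 0 := by
    rw [hsub, finsum_mem_coe_finset, Finset.sum_filter]
  refine ⟨hsub ▸ Finset.finite_toSet _, ?_, fun heq => ?_⟩
  · rw [hsum, ← hr]
    exact Finset.sum_le_sum fun j _ => hle j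
  · rw [hsum, ← hr] at heq
    have hb₀ (j) : b₀ j = if D j ≤ -1 then (D j).natAbs else 0 := by
      by_cases hj : j ∈ T
      · exact ((Finset.sum_eq_sum_iff_of_le fun j _ => hle j).1 heq.symm j hj).symm
      · have := hle j
        have := hT j hj
        omega
    refine ⟨hb₀, fun j => ?_⟩
    have h1 := hD j
    have h2 := hb₀ j
    -- In degree `0` the summand `1` spoils `D j = b₁ j - b₀ j`, so `h₁` is used instead.
    by_cases hj : j = 0
    · subst hj
      simp [h₁]
    · rw [if_neg hj] at h1
      split_ifs at h2 ⊢ <;> omega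

lemma IsPerfect.projectiveDimension_le_height {R : Type*} [CommRing R] [IsNoetherianRing R]
    {I : Ideal R} (hI : IsPerfect I) :
    CategoryTheory.projectiveDimension (ModuleCat.of R (R ⧸ I)) ≤ (I.height : WithBot ℕ∞) := by
  rw [hI.2]
  exact WithBot.coe_le_coe.2 grade_le_height

lemma height_le_of_ne_top {k : Type*} [Field k] {n : ℕ} {J : Ideal (MvPolynomial (Fin n) k)}
    (hJ : J ≠ ⊤) : J.height ≤ n := by
  have h := Ideal.height_le_ringKrullDim_of_ne_top hJ
  rw [MvPolynomial.ringKrullDim_of_isNoetherianRing, ringKrullDim_eq_zero_of_field, zero_add,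
    Nat.card_fin] at h
  exact WithBot.coe_le_coe.1 h

namespace MinimalGradedFreeResolution

variable {k : Type*} [Field k] {n : ℕ} {J : Ideal (MvPolynomial (Fin n) k)}
  (F : MinimalGradedFreeResolution J)

/-- A basis element of degree `0` in `F₁` would have constant coordinates under `F.d 0`; minimality
makes them zero, against injectivity. -/
lemma betti_one_zero (hF : Function.Injective (F.d 0)) : F.betti 1 0 = 0 := by
  rw [betti, Finset.card_eq_zero, Finset.filter_eq_empty_iff]
  intro l _ hl
  have h0 : F.d 0 (Pi.single l 1) = 0 := by
    ext m e
    by_contra he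
    have hdeg := F.homogeneous_d 0 l m e (mem_support_iff.2 he)
    have he0 : e = 0 := by
      rw [← Finsupp.degree_eq_zero_iff]
      change _ = F.shift 1 l at hdeg
      omega
    subst he0
    exact he (F.minimal 0 l m)
  have := congrFun (hF (h0.trans (map_zero _).symm)) l
  simp at this

lemma betti_eq_zero_of_rank_eq_zero {i : ℕ} (hi : F.rank i = 0) (j : ℕ) : F.betti i j = 0 := by
  rw [← Nat.le_zero, ← hi]
  exact (Finset.card_filter_le _ _).trans_eq (Finset.card_fin _)

lemma sum_betti (i : ℕ) :
    ∑ j ∈ Finset.univ.image (F.shift i), F.betti i j = F.rank i := by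
  exact (Finset.card_eq_sum_card_image (F.shift i) Finset.univ).symm.trans (Finset.card_fin _)

end MinimalGradedFreeResolution

end GradedIdeal

/-! ### The main theorem -/

theorem theorem1p1 {k : Type*} [Field k] {n : ℕ} (J : Ideal (MvPolynomial (Fin n) k))
    (hhom : J.IsHomogeneous (MvPolynomial.homogeneousSubmodule (Fin n) k))
    (hperf : GradedIdeal.IsPerfect J) (hht : J.height = 2)
    (h : ℕ → ℤ) (hh : h = GradedIdeal.hVector J) :
    -- the sum over the indices with `Δ²h ≤ -1` is finite, and it bounds `ν(J)` from below
    {i | GradedIdeal.diff2 h i ≤ -1}.Finite ∧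
    ∑ᶠ i ∈ {i | GradedIdeal.diff2 h i ≤ -1}, (GradedIdeal.diff2 h i).natAbs ≤ GradedIdeal.nu J ∧
    -- the graded Betti numbers of `J` make sense, and equality determines them all; the index `0`,
    -- where `Δ²h(0) = 1` only accounts for the summand `P` in the resolution of `P ⧸ J`, is excluded
    Nonempty (GradedIdeal.MinimalGradedFreeResolution J) ∧
    (GradedIdeal.nu J =
        ∑ᶠ i ∈ {i | GradedIdeal.diff2 h i ≤ -1}, (GradedIdeal.diff2 h i).natAbs →
      ∀ F : GradedIdeal.MinimalGradedFreeResolution J,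
        (∀ j, F.betti 0 j =
          if GradedIdeal.diff2 h j ≤ -1 then (GradedIdeal.diff2 h j).natAbs else 0) ∧
        (∀ j, F.betti 1 j =
          if 1 ≤ j ∧ 1 ≤ GradedIdeal.diff2 h j then (GradedIdeal.diff2 h j).natAbs else 0) ∧
        ∀ i j, 2 ≤ i → F.betti i j = 0) := by
  subst hh
  -- This makes the truncated exponent `n - 2` in `hVector` an honest difference.
  have hn : 2 ≤ n := by
    have := GradedIdeal.height_le_of_ne_top hperf.1
    rw [hht] at this
    exact_mod_cast this
  have hpd : CategoryTheory.projectiveDimension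
      (ModuleCat.of (MvPolynomial (Fin n) k) (MvPolynomial (Fin n) k ⧸ J)) ≤ 2 :=
    hperf.projectiveDimension_le_height.trans_eq (by rw [hht]; rfl)
  have key (F : GradedIdeal.MinimalGradedFreeResolution J) :=
    GradedIdeal.finsum_natAbs_le_and_eq (F.diff2_hVector hn (F.injective_d_zero hpd))
      (F.betti_one_zero (F.injective_d_zero hpd))
      (T := Finset.univ.image (F.shift 0)) (fun j hj => by
        rw [GradedIdeal.MinimalGradedFreeResolution.betti, Finset.card_eq_zero,
          Finset.filter_eq_empty_iff]
        exact fun l _ hl => hj (Finset.mem_image.2 ⟨l, Finset.mem_univ l, hl⟩))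
      ((F.sum_betti 0).trans F.nu_eq_rank_zero.symm)
  obtain ⟨F₀⟩ := GradedIdeal.nonempty_minimalGradedFreeResolution hhom
  refine ⟨(key F₀).1, (key F₀).2.1, ⟨F₀⟩, fun heq F => ?_⟩
  obtain ⟨h0, h1⟩ := (key F).2.2 heq
  refine ⟨h0, h1, fun i j hi => ?_⟩
  obtain ⟨i, rfl⟩ := Nat.exists_eq_add_of_le' hi
  exact F.betti_eq_zero_of_rank_eq_zero (F.rank_eq_zero_of_injective (F.injective_d_zero hpd) i) j
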